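/- Let $d\ge 1$, write $\|\cdot\|$ for the Euclidean norm, and let $\pi_d$ be the volume of the unit ball of $\mathbb{R}^d$. For a finite family $S$ of points of $[0,1]^d$ and $r>0$, let $G(S;r)$ be the graph on $S$ in which two different members $u,v$ are adjacent, $u\sim v$, if and only if $\|u-v\|\le r$, and let $P(G)_{uv}=[u\sim v]/|N(u)|$, with $N(u)$ the set of neighbours of $u$, be the transition matrix of the simple random walk on a graph $G$ (the row of an isolated vertex is taken to be $0$). All eigenvalues of $P(G)$ are real. Spectra are taken with multiplicity, and the spectral measure of a graph with $n$ vertices gives mass $1/n$ to each of the $n$ eigenvalues, so that $\mu(-\infty,x]=\frac1n|\{\lambda\in\mathrm{Spec}:\lambda\le x\}|$. Let $n$ tend to infinity along an infinite set $N$ of sizes (for example all positive integers, or the $d$-th powers $m^d$). For each $n\in N$ let $\mathcal{X}_n$ consist of $n$ independent uniform points of $[0,1]^d$, let $\mathcal{D}_n\subset[0,1]^d$ be a set of $n$ grid points, all of them intersections of axis-parallel lines with separation $n^{-1/d}$, and let $r(n)>0$. Let $$M_n=\min_{\phi}\max_{u\in\mathcal{X}_n}\|u-\phi(u)\|$$ be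 the minimum bottleneck matching distance, where $\phi$ runs over the bijections $\mathcal{X}_n\to\mathcal{D}_n$. Events $A_n$ are said to hold with high probability if for some $c>0$ one has $\Pr(A_n)>1-n^{-c}$ for all large $n\in N$. Assume that $M_n=o(r(n))$ with high probability, that is, for every $\varepsilon>0$ the events $\{M_n\le\varepsilon r(n)\}$ hold with high probability. Write $a(n)=n\pi_d r(n)^d$, and let $\mu_{\mathcal{X}_n}$ and $\mu_{\mathcal{D}_n}$ be the spectral measures of $P(G(\mathcal{X}_n;r(n)))$ and $P(G(\mathcal{D}_n;r(n)))$. (i) The spectra of $P(G(\mathcal{X}_n;r(n)))$ and $P(G(\mathcal{D}_n;r(n)))$ are asymptotically equidistributed with high probability: there are events $A_n$ that hold with high probability such that, for every choice of outcomes in the $A_n$, the eigenvalues $\lambda_i(\mathcal{X}_n)$ and $\lambda_i(\mathcal{D}_n)$ satisfy, for every continuous $f:\mathbb{R}\to\mathbb{R}$, $$\lim_{n\to\infty}\left|\frac1n\sum_{i=1}^n f(\lambda_i(\mathcal{X}_n))-\frac1n\sum_{i=1}^n f(\lambda_i(\mathcal{D}_n))\right|=0 .$$ (ii) There is a constant $c_d>0$,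 depending only on $d$, such that for all $n\in N$ with $n\ge 1$ and all $t>0$, $$\Pr\left\{\|\mu_{\mathcal{X}_n}-\mu_{\mathcal{D}_n}\|_{\mathrm{WS}}>\frac{t}{a(n)^{1/4}}\right\}\le\frac{16\,n\,a(n)^{1/4}}{t}\left[2\exp\left(-\frac12\left(\frac{t^4}{8t^4+4096}\right)^2a(n)\right)+\exp\left(-c_d\frac{t^8}{512}a(n)\right)\right],$$ where $\|\mu-\nu\|_{\mathrm{WS}}=\sup_f\left|\int f\,d\mu-\int f\,d\nu\right|$, with the supremum over the functions $f:\mathbb{R}\to\mathbb{R}$ with Lipschitz constant at most $1$. -/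

import Mathlib

open MeasureTheory ProbabilityTheory Filter Topology
open scoped ENNReal NNReal

namespace RGG

/-- Euclidean space of dimension `d`. -/
abbrev E (d : ℕ) : Type := EuclideanSpace ℝ (Fin d)

/-- The cube `[0,1]^d`. -/
def cube (d : ℕ) : Set (E d) := {x | ∀ j, x j ∈ Set.Icc (0 : ℝ) 1}

/-- The volume of the unit ball of `ℝ^d`. -/
noncomputable def unitBallVolume (d : ℕ) : ℝ :=
  (volume : Measure (E d)).real (Metric.ball 0 1)

/-- The geometric graph `G(S; r)` on the labelled points `p i`: distinct labels are joined when
their points are at distance at most `r`. -/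
def geomGraph {d n : ℕ} (p : Fin n → E d) (r : ℝ) : SimpleGraph (Fin n) where
  Adj i j := i ≠ j ∧ ‖p i - p j‖ ≤ r
  symm := ⟨fun i j h => ⟨h.1.symm, by rw [norm_sub_rev]; exact h.2⟩⟩
  loopless := ⟨fun _ h => h.1 rfl⟩

open scoped Classical in
/-- Transition matrix of the simple random walk, `P u v = [u ∼ v] / |N(u)|`
(the row of an isolated vertex is zero). -/
noncomputable def walkMatrix {n : ℕ} (G : SimpleGraph (Fin n)) : Matrix (Fin n) (Fin n) ℝ :=
  Matrix.of fun u v => if G.Adj u v then 1 / ((G.neighborSet u).ncard : ℝ) else 0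

/-- The spectrum as a multiset: the eigenvalues with algebraic multiplicity. The walk is
reversible, so that all of its eigenvalues are real. -/
noncomputable def spec {n : ℕ} (A : Matrix (Fin n) (Fin n) ℝ) : Multiset ℝ := A.charpoly.roots

/-- The spectral measure: mass `1 / n` at each eigenvalue, counted with multiplicity. -/
noncomputable def spectralMeasure {n : ℕ} (A : Matrix (Fin n) (Fin n) ℝ) : Measure ℝ :=
  (n : ℝ≥0∞)⁻¹ • ((spec A).map Measure.dirac).sum

/-- The Wasserstein distance, in its dual form with `1`-Lipschitz test functions. -/
noncomputable def wasserstein (μ ν : Measure ℝ) : ℝ≥0∞ :=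
  ⨆ (f : ℝ → ℝ) (_ : LipschitzWith 1 f), ENNReal.ofReal |∫ x, f x ∂μ - ∫ x, f x ∂ν|

/-- The minimum bottleneck matching distance between two families of `n` points. -/
noncomputable def bottleneck {d n : ℕ} (p q : Fin n → E d) : ℝ :=
  ⨅ σ : Equiv.Perm (Fin n), ⨆ i : Fin n, ‖p i - q (σ i)‖

/-- `q` lists `n` distinct points of `[0,1]^d`, all of them intersections of axis-parallel lines
with separation `n^(-1/d)`. -/
structure IsGrid {d n : ℕ} (q : Fin n → E d) : Prop where
  injective : Function.Injective q
  mem_cube : ∀ i, q i ∈ cube d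
  on_lines : ∃ s : Fin d → ℝ, ∀ i j, ∃ k : ℤ, q i j = s j + k * (n : ℝ) ^ (-(1 : ℝ) / d)

/-- The limit `n → ∞` along the set `N` of sizes. -/
def atTopIn (N : Set ℕ) : Filter ℕ := atTop ⊓ 𝓟 N

/-- With high probability: for some `c > 0`, the `n`-th event has probability greater than
`1 - n^(-c)` for all large `n` in `N`. -/
def Whp {Ω : Type*} [MeasurableSpace Ω] (P : Measure Ω) (N : Set ℕ) (A : ℕ → Set Ω) : Prop :=
  ∃ c : ℝ, 0 < c ∧ ∀ᶠ n : ℕ in atTopIn N, 1 - (n : ℝ) ^ (-c) < P.real (A n)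

/-- Asymptotic equidistribution of two sequences of `n`-element multisets of reals. -/
def AsympEquidistributed (N : Set ℕ) (S T : ℕ → Multiset ℝ) : Prop :=
  ∀ f : ℝ → ℝ, Continuous f →
    Tendsto (fun n : ℕ => |1 / (n : ℝ) * ((S n).map f).sum - 1 / (n : ℝ) * ((T n).map f).sum|)
      (atTopIn N) (𝓝 0)

/-- Two sequences of random multisets are asymptotically equidistributed with high probability:
there are events `A n` that hold with high probability such that every choice of outcomes
`ω n ∈ A n` yields asymptotically equidistributed sequences. -/
def AsympEquidistributedWhp {Ω : Type*} [MeasurableSpace Ω] (P : Measure Ω) (N : Set ℕ)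
    (S T : ℕ → Ω → Multiset ℝ) : Prop :=
  ∃ A : ℕ → Set Ω, (∀ n, MeasurableSet (A n)) ∧ Whp P N A ∧
    ∀ ω : ℕ → Ω, (∀ᶠ n in atTopIn N, ω n ∈ A n) →
      AsympEquidistributed N (fun n => S n (ω n)) (fun n => T n (ω n))

end RGG

/-!
Both spectral measures collapse to the point mass at `0`, at a deterministic rate. All that matters
about the two point families is that they lie in the cube.

The transition matrix `P` is conjugate to a symmetric matrix, so the sum of its squared eigenvalues
is `tr P² = ∑_{u ∼ v} 1 / (d(u) d(v)) ≤ ∑_u 1 / d(u)` (`trace_walkMatrix_sq_le`,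
`exists_spec_eq`). In a geometric graph the points of a cell of side `r / √d` form a clique, and the
members of a clique of size `s` have degree at least `s - 1`, so the sum of `1 / (d(u) + 1)` is at
most the number `(√d / r + 1)^d` of cells (`sum_inv_deg_geomGraph_le`). For `r ≤ √d` the mean square
of the eigenvalues is therefore at most `K_d / a`, with `a = n π_d r^d`; it is also at most `1`.
For `r ≥ √d` both graphs are complete.

For (i), a uniform point is, with probability at least `1/2`, at distance of order `n^(-1/d)` from
every one of the `n` grid points, so that `M_n = o(r(n))` forces `r(n) n^(1/d) → ∞`
(`tendsto_radius_atTop`). Then the mean square of the eigenvalues tends to `0` on both sides, and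
both means of `f` tend to `f 0` (`tendsto_mean_spec`). The events `A_n` say that all the points lie
in the cube.

For (ii), the Wasserstein distance is almost surely at most `2 √(min 1 (K_d / a))`
(`wasserstein_geomGraph_le`). So the probability is `0` unless `t / a^(1/4)` is below this value;
in that case `t < 2 a^(1/4)`, whence `16 n a^(1/4) / t ≥ 8`, and `t⁸ a` is bounded in terms of `d`
(`pow_eight_mul_le`). A constant `c_d` small enough in terms of that bound keeps the last
exponential above `e⁻¹`, and the right-hand side is then at least `8 / e > 1`.
-/

namespace RGG

/-! ### The spectrum of the simple random walk -/

section Walk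

variable {n : ℕ} (G : SimpleGraph (Fin n))

/-- The degree of a vertex, as a real number. -/
noncomputable def deg (u : Fin n) : ℝ := (G.neighborSet u).ncard

variable {G}

lemma deg_nonneg (u : Fin n) : 0 ≤ deg G u := Nat.cast_nonneg _

lemma deg_pos {u v : Fin n} (h : G.Adj u v) : 0 < deg G u := by
  unfold deg
  exact_mod_cast (Set.ncard_pos (Set.toFinite _)).2 ⟨v, h⟩

open scoped Classical in
lemma sum_adj_eq (u : Fin n) (x : ℝ) : ∑ v, (if G.Adj u v then x else 0) = deg G u * x := by
  rw [← Finset.sum_filter, Finset.sum_const, nsmul_eq_mul, deg, ← Set.ncard_coe_finset]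
  congr 3
  ext v
  simp

open scoped Classical in
lemma walkMatrix_apply (u v : Fin n) :
    walkMatrix G u v = if G.Adj u v then 1 / deg G u else 0 := rfl

/-- Reversibility: conjugating the transition matrix by `D^(1/2)`, where `D` is the diagonal matrix
of degrees, makes it symmetric. -/
lemma exists_isHermitian_charpoly_eq : ∃ S : Matrix (Fin n) (Fin n) ℝ, S.IsHermitian ∧
    (walkMatrix G).charpoly = S.charpoly ∧
    (walkMatrix G * walkMatrix G).trace = (S * S).trace := by
  classical
  -- isolated vertices have zero rows and columns, so that they may be given weight `1`
  set w : Fin n → ℝ := fun u => if deg G u = 0 then 1 else √(deg G u) with hw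
  have hw0 : ∀ u, w u ≠ 0 := by
    intro u
    by_cases h : deg G u = 0
    · simp [hw, h]
    · simp [hw, h, Real.sqrt_eq_zero (deg_nonneg u)]
  have hw2 : ∀ {u v}, G.Adj u v → w u * w u = deg G u := by
    intro u v h
    simp [hw, (deg_pos h).ne', Real.mul_self_sqrt (deg_nonneg u)]
  set S : Matrix (Fin n) (Fin n) ℝ :=
    Matrix.of fun u v => if G.Adj u v then 1 / (w u * w v) else 0 with hS
  have h1 : Matrix.diagonal w * Matrix.diagonal (fun u => (w u)⁻¹) = 1 := by
    simp [Matrix.diagonal_mul_diagonal, hw0]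
  have hP : walkMatrix G = Matrix.diagonal (fun u => (w u)⁻¹) * (S * Matrix.diagonal w) := by
    ext u v
    rw [Matrix.diagonal_mul, Matrix.mul_diagonal, walkMatrix_apply, hS, Matrix.of_apply]
    split_ifs with h
    · rw [← hw2 h]
      have := hw0 u
      have := hw0 v
      field_simp
    · simp
  refine ⟨S, ?_, ?_, ?_⟩
  · ext u v
    simp [hS, G.adj_comm, mul_comm]
  · rw [hP, Matrix.charpoly_mul_comm, Matrix.mul_assoc, h1, Matrix.mul_one]
  · have : walkMatrix G * walkMatrix G =
        Matrix.diagonal (fun u => (w u)⁻¹) * (S * S * Matrix.diagonal w) := by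
      calc _ = Matrix.diagonal (fun u => (w u)⁻¹) * (S *
            (Matrix.diagonal w * Matrix.diagonal (fun u => (w u)⁻¹)) * S * Matrix.diagonal w) := by
            rw [hP]; simp only [Matrix.mul_assoc]
        _ = _ := by rw [h1, Matrix.mul_one]
    rw [this, Matrix.trace_mul_comm, Matrix.mul_assoc, h1, Matrix.mul_one]

lemma sum_eigenvalues_sq {S : Matrix (Fin n) (Fin n) ℝ} (hS : S.IsHermitian) :
    ∑ i, hS.eigenvalues i ^ 2 = (S * S).trace := by
  have h := hS.spectral_theorem
  conv_rhs => rw [h]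
  rw [← map_mul, Matrix.diagonal_mul_diagonal, Unitary.conjStarAlgAut_apply,
    Matrix.trace_mul_comm, ← Matrix.mul_assoc]
  simp [Matrix.trace_diagonal, sq]

/-- `tr P²` weighs an edge `uv` by `1 / (d(u) d(v))`, at most the mean of `1 / d(u)²` and
`1 / d(v)²`. -/
lemma trace_walkMatrix_sq_le : (walkMatrix G * walkMatrix G).trace ≤ ∑ u, (deg G u)⁻¹ := by
  classical
  have hrow : ∑ u, ∑ v, (if G.Adj u v then (deg G u)⁻¹ ^ 2 else 0) = ∑ u, (deg G u)⁻¹ := by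
    refine Finset.sum_congr rfl fun u _ => ?_
    rw [sum_adj_eq]
    by_cases h : deg G u = 0
    · simp [h]
    · field_simp
  have hcol : ∑ u, ∑ v, (if G.Adj u v then (deg G v)⁻¹ ^ 2 else 0) = ∑ u, (deg G u)⁻¹ := by
    rw [Finset.sum_comm, ← hrow]
    simp only [G.adj_comm]
  have : ∑ u, (deg G u)⁻¹ = ∑ u, ∑ v, ((if G.Adj u v then (deg G u)⁻¹ ^ 2 else 0) +
      (if G.Adj u v then (deg G v)⁻¹ ^ 2 else 0)) / 2 := by
    simp only [← Finset.sum_div, Finset.sum_add_distrib, hrow, hcol]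
    ring
  rw [this, Matrix.trace]
  refine Finset.sum_le_sum fun u _ => ?_
  rw [Matrix.diag_apply, Matrix.mul_apply]
  refine Finset.sum_le_sum fun v _ => ?_
  rw [walkMatrix_apply, walkMatrix_apply, G.adj_comm v u]
  split_ifs
  · rw [one_div, one_div]
    nlinarith [sq_nonneg ((deg G u)⁻¹ - (deg G v)⁻¹)]
  · simp

/-- Each row of the transition matrix has sum at most `1` and zero diagonal: Gershgorin. -/
lemma abs_le_one_of_mem_spec {x : ℝ} (hx : x ∈ spec (walkMatrix G)) : |x| ≤ 1 := by
  classical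
  have hroot := (Polynomial.mem_roots (walkMatrix G).charpoly_monic.ne_zero).1 hx
  have hev : Module.End.HasEigenvalue (Matrix.toLin' (walkMatrix G)) x := by
    rw [Module.End.hasEigenvalue_iff_isRoot_charpoly, Matrix.charpoly_toLin']
    exact hroot
  obtain ⟨k, hk⟩ := eigenvalue_mem_ball hev
  have h0 : walkMatrix G k k = 0 := by simp [walkMatrix_apply]
  rw [h0, mem_closedBall_zero_iff, Real.norm_eq_abs] at hk
  refine hk.trans ?_
  calc ∑ j ∈ Finset.univ.erase k, ‖walkMatrix G k j‖ ≤ ∑ j, ‖walkMatrix G k j‖ :=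
        Finset.sum_le_sum_of_subset_of_nonneg (Finset.erase_subset _ _) fun _ _ _ => norm_nonneg _
    _ = ∑ j, (if G.Adj k j then 1 / deg G k else 0) := by
        refine Finset.sum_congr rfl fun j _ => ?_
        rw [walkMatrix_apply, Real.norm_eq_abs, abs_of_nonneg]
        split_ifs
        · exact one_div_nonneg.2 (deg_nonneg k)
        · exact le_rfl
    _ ≤ 1 := by
        rw [sum_adj_eq, mul_one_div]
        exact div_self_le_one _

variable (G) in
lemma exists_spec_eq : ∃ e : Fin n → ℝ, spec (walkMatrix G) = Finset.univ.val.map e ∧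
    (∀ i, |e i| ≤ 1) ∧ ∑ i, e i ^ 2 ≤ ∑ u, (deg G u)⁻¹ := by
  obtain ⟨S, hS, hc, ht⟩ := exists_isHermitian_charpoly_eq (G := G)
  have hspec : spec (walkMatrix G) = Finset.univ.val.map hS.eigenvalues := by
    rw [spec, hc, hS.roots_charpoly_eq_eigenvalues]
    rfl
  refine ⟨hS.eigenvalues, hspec, fun i => abs_le_one_of_mem_spec (G := G) ?_, ?_⟩
  · rw [hspec]
    exact Multiset.mem_map_of_mem _ (Finset.mem_univ i)
  · rw [sum_eigenvalues_sq, ← ht]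
    exact trace_walkMatrix_sq_le

/-! ### Clique covers and inverse degrees -/

/-- If each colour class is a clique, a vertex of a class of size `s` has degree at least `s - 1`,
so each class contributes at most `1` to the sum. -/
lemma sum_inv_deg_add_one_le {C : Type*} [DecidableEq C] (κ : Fin n → C) (T : Finset C)
    (hT : ∀ u, κ u ∈ T) (hκ : ∀ u v, u ≠ v → κ u = κ v → G.Adj u v) :
    ∑ u, (deg G u + 1)⁻¹ ≤ T.card := by
  rw [← Finset.sum_fiberwise_of_maps_to (fun u _ => hT u), ← nsmul_one, ← Finset.sum_const]
  refine Finset.sum_le_sum fun c _ => ?_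
  set F := Finset.univ.filter fun u => κ u = c with hF
  have hdeg : ∀ u ∈ F, (F.card : ℝ) ≤ deg G u + 1 := by
    intro u hu
    have hsub : ((F.erase u : Finset (Fin n)) : Set (Fin n)) ⊆ G.neighborSet u := by
      intro v hv
      simp only [hF, Finset.coe_erase, Finset.coe_filter, Finset.mem_univ, true_and,
        Set.mem_sdiff, Set.mem_ofPred_eq, Set.mem_singleton_iff] at hv
      exact hκ u v (Ne.symm hv.2) ((Finset.mem_filter.1 hu).2.trans hv.1.symm)
    have := Set.ncard_le_ncard hsub (Set.toFinite _)
    rw [Set.ncard_coe_finset, Finset.card_erase_of_mem hu] at this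
    have h' : F.card ≤ (G.neighborSet u).ncard + 1 := by omega
    unfold deg
    exact_mod_cast h'
  rcases F.eq_empty_or_nonempty with h | h
  · simp [h]
  · have hpos : (0 : ℝ) < F.card := by exact_mod_cast h.card_pos
    calc ∑ u ∈ F, (deg G u + 1)⁻¹ ≤ ∑ _u ∈ F, (F.card : ℝ)⁻¹ :=
          Finset.sum_le_sum fun u hu => inv_anti₀ hpos (hdeg u hu)
      _ = 1 := by rw [Finset.sum_const, nsmul_eq_mul, mul_inv_cancel₀ hpos.ne']

lemma sum_inv_deg_le_two_mul : ∑ u, (deg G u)⁻¹ ≤ 2 * ∑ u, (deg G u + 1)⁻¹ := by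
  rw [Finset.mul_sum]
  refine Finset.sum_le_sum fun u _ => ?_
  rcases Nat.eq_zero_or_pos (G.neighborSet u).ncard with h | h
  · simp [deg, h]
  · have h1 : (1 : ℝ) ≤ deg G u := by unfold deg; exact_mod_cast h
    rw [← div_eq_mul_inv, le_div_iff₀ (by linarith), inv_mul_le_iff₀ (by linarith)]
    linarith

lemma sum_inv_deg_le_card : ∑ u, (deg G u)⁻¹ ≤ n := by
  calc ∑ u, (deg G u)⁻¹ ≤ ∑ _u : Fin n, (1 : ℝ) := by
        refine Finset.sum_le_sum fun u _ => ?_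
        exact Nat.cast_inv_le_one _
    _ = n := by simp

end Walk

section Geometry

variable {d n : ℕ} {p : Fin n → E d} {r : ℝ}

/-- Cut the cube into cells of side `r / √d`: there are at most `(√d / r + 1)^d` of them, and
the points of one cell form a clique. -/
lemma sum_inv_deg_geomGraph_le (hd : 1 ≤ d) (hp : ∀ i, p i ∈ cube d) (hr : 0 < r) :
    ∑ u, (deg (geomGraph p r) u)⁻¹ ≤ 2 * (√d / r + 1) ^ d := by
  classical
  have hd0 : 0 < √(d : ℝ) := Real.sqrt_pos.2 (by exact_mod_cast hd)
  set s : ℝ := r / √d with hs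
  have hs0 : 0 < s := div_pos hr hd0
  have hkey : ∑ u, (deg (geomGraph p r) u + 1)⁻¹ ≤
      ((Fintype.piFinset fun _ : Fin d => Finset.range (⌊1 / s⌋₊ + 1)).card : ℝ) := by
    refine sum_inv_deg_add_one_le (fun u j => ⌊p u j / s⌋₊) _ (fun u => ?_) fun u v huv h => ?_
    · rw [Fintype.mem_piFinset]
      intro j
      rw [Finset.mem_range, Nat.lt_succ_iff]
      exact Nat.floor_le_floor (div_le_div_of_nonneg_right (hp u j).2 hs0.le)
    · refine ⟨huv, ?_⟩
      have hcoord : ∀ j, |p u j - p v j| ≤ s := by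
        intro j
        have hj : ⌊p u j / s⌋₊ = ⌊p v j / s⌋₊ := congrFun h j
        have hu0 : 0 ≤ p u j / s := div_nonneg (hp u j).1 hs0.le
        have hv0 : 0 ≤ p v j / s := div_nonneg (hp v j).1 hs0.le
        have h1 := Nat.floor_le hu0
        have h2 := Nat.lt_floor_add_one (p u j / s)
        have h3 := Nat.floor_le hv0
        have h4 := Nat.lt_floor_add_one (p v j / s)
        rw [hj] at h1 h2
        have h5 : |p u j / s - p v j / s| ≤ 1 := by rw [abs_le]; constructor <;> linarith
        rwa [← sub_div, abs_div, abs_of_pos hs0, div_le_one hs0] at h5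
      have hsq : ∑ j, ‖(p u - p v) j‖ ^ 2 ≤ r ^ 2 := by
        calc ∑ j, ‖(p u - p v) j‖ ^ 2 ≤ ∑ _j : Fin d, s ^ 2 :=
              Finset.sum_le_sum fun j _ => by
                rw [PiLp.sub_apply, Real.norm_eq_abs]
                exact pow_le_pow_left₀ (abs_nonneg _) (hcoord j) 2
          _ = r ^ 2 := by
              rw [Finset.sum_const, Finset.card_univ, Fintype.card_fin, nsmul_eq_mul, hs, div_pow,
                Real.sq_sqrt (Nat.cast_nonneg d)]
              field_simp
      rw [EuclideanSpace.norm_eq]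
      exact (Real.sqrt_le_sqrt hsq).trans_eq (Real.sqrt_sq hr.le)
  refine sum_inv_deg_le_two_mul.trans (mul_le_mul_of_nonneg_left (hkey.trans ?_) two_pos.le)
  rw [Fintype.card_piFinset, Finset.prod_const, Finset.card_range, Finset.card_univ,
    Fintype.card_fin]
  push_cast
  refine pow_le_pow_left₀ (by positivity) ?_ d
  have h1 : 1 / s = √d / r := by rw [hs, one_div_div]
  rw [h1]
  have := Nat.floor_le (div_nonneg hd0.le hr.le)
  linarith

lemma norm_sub_le_sqrt {x y : E d} (hx : x ∈ cube d) (hy : y ∈ cube d) : ‖x - y‖ ≤ √d := by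
  rw [EuclideanSpace.norm_eq]
  refine Real.sqrt_le_sqrt ?_
  calc ∑ j, ‖(x - y) j‖ ^ 2 ≤ ∑ _j : Fin d, (1 : ℝ) := by
        refine Finset.sum_le_sum fun j _ => ?_
        rw [PiLp.sub_apply, Real.norm_eq_abs, sq_le_one_iff_abs_le_one, abs_abs, abs_le]
        constructor <;> linarith [(hx j).1, (hx j).2, (hy j).1, (hy j).2]
    _ = d := by simp

lemma geomGraph_eq_top (hp : ∀ i, p i ∈ cube d) (hr : √d ≤ r) : geomGraph p r = ⊤ := by
  ext i j
  simp only [geomGraph, SimpleGraph.top_adj, and_iff_left_iff_imp]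
  exact fun _ => (norm_sub_le_sqrt (hp i) (hp j)).trans hr

end Geometry

/-! ### Concentration of the spectral measure at zero -/

section Spectral

variable {n : ℕ}

lemma integral_spectralMeasure {A : Matrix (Fin n) (Fin n) ℝ} {e : Fin n → ℝ}
    (he : spec A = Finset.univ.val.map e) (f : ℝ → ℝ) :
    ∫ x, f x ∂(spectralMeasure A) = (n : ℝ)⁻¹ * ∑ i, f (e i) := by
  have hsum : ((spec A).map Measure.dirac).sum = ∑ i, Measure.dirac (e i) := by
    rw [he, Multiset.map_map]
    rfl
  rw [spectralMeasure, hsum, integral_smul_measure, integral_finsetSum_measure]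
  · simp
  · exact fun i _ => integrable_dirac enorm_lt_top

lemma sum_abs_le_mul_sqrt {e : Fin n → ℝ} {Q : ℝ} (he : ∑ i, e i ^ 2 ≤ n * Q) :
    ∑ i, |e i| ≤ n * √Q := by
  have h1 : (∑ i, |e i|) ^ 2 ≤ n ^ 2 * Q := by
    calc (∑ i, |e i|) ^ 2 ≤ n * ∑ i, |e i| ^ 2 := by
          simpa using sq_sum_le_card_mul_sum_sq (s := Finset.univ) (f := fun i => |e i|)
      _ ≤ n * (n * Q) := by
          simp only [sq_abs]
          exact mul_le_mul_of_nonneg_left he (Nat.cast_nonneg n)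
      _ = n ^ 2 * Q := by ring
  calc ∑ i, |e i| ≤ √(n ^ 2 * Q) := Real.le_sqrt_of_sq_le h1
    _ = n * √Q := by rw [Real.sqrt_mul (sq_nonneg _), Real.sqrt_sq (Nat.cast_nonneg n)]

lemma abs_integral_spectralMeasure_sub_le (hn : 1 ≤ n) (G : SimpleGraph (Fin n)) {Q : ℝ}
    (hQ : ∑ u, (deg G u)⁻¹ ≤ n * Q) {f : ℝ → ℝ} (hf : LipschitzWith 1 f) :
    |∫ x, f x ∂(spectralMeasure (walkMatrix G)) - f 0| ≤ √Q := by
  obtain ⟨e, he, -, he2⟩ := exists_spec_eq G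
  have hn0 : (0 : ℝ) < n := by exact_mod_cast hn
  have h1 : (n : ℝ)⁻¹ * ∑ i, f (e i) - f 0 = (n : ℝ)⁻¹ * ∑ i, (f (e i) - f 0) := by
    rw [Finset.sum_sub_distrib, mul_sub]
    simp [hn0.ne']
  rw [integral_spectralMeasure he, h1, abs_mul, abs_of_pos (inv_pos.2 hn0),
    inv_mul_le_iff₀ hn0]
  calc |∑ i, (f (e i) - f 0)| ≤ ∑ i, |f (e i) - f 0| := Finset.abs_sum_le_sum_abs _ _
    _ ≤ ∑ i, |e i| := by
        refine Finset.sum_le_sum fun i _ => ?_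
        simpa [Real.dist_eq] using hf.dist_le_mul (e i) 0
    _ ≤ n * √Q := sum_abs_le_mul_sqrt (he2.trans hQ)

/-- Both spectral measures are within `√Q` of the point mass at `0`. -/
lemma wasserstein_walkMatrix_le (hn : 1 ≤ n) (G H : SimpleGraph (Fin n)) {Q : ℝ}
    (hG : ∑ u, (deg G u)⁻¹ ≤ n * Q) (hH : ∑ u, (deg H u)⁻¹ ≤ n * Q) :
    wasserstein (spectralMeasure (walkMatrix G)) (spectralMeasure (walkMatrix H)) ≤
      ENNReal.ofReal (2 * √Q) := by
  refine iSup₂_le fun f hf => ENNReal.ofReal_le_ofReal ?_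
  have h1 := abs_le.1 (abs_integral_spectralMeasure_sub_le hn G hG hf)
  have h2 := abs_le.1 (abs_integral_spectralMeasure_sub_le hn H hH hf)
  rw [abs_le]
  constructor <;> linarith [h1.1, h1.2, h2.1, h2.2]

lemma wasserstein_self (μ : Measure ℝ) : wasserstein μ μ = 0 := by
  simp [wasserstein]

/-- The eigenvalues lie in `[-1, 1]` and their mean square tends to `0`; on `[-1, 1]` a continuous
`f` satisfies `|f x - f 0| ≤ ε + C x²`. -/
lemma tendsto_mean_spec {l : Filter ℕ} (hl : l ≤ atTop) (G : (n : ℕ) → SimpleGraph (Fin n))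
    {q : ℕ → ℝ} (hq : Tendsto q l (𝓝 0)) (hG : ∀ᶠ n in l, ∑ u, (deg (G n) u)⁻¹ ≤ n * q n)
    {f : ℝ → ℝ} (hf : Continuous f) :
    Tendsto (fun n : ℕ => 1 / (n : ℝ) * ((spec (walkMatrix (G n))).map f).sum) l (𝓝 (f 0)) := by
  rw [Metric.tendsto_nhds]
  intro ε hε
  obtain ⟨δ, hδ, hfδ⟩ := Metric.continuousAt_iff.1 (hf.continuousAt (x := 0)) (ε / 2) (half_pos hε)
  obtain ⟨B, hB⟩ := (isCompact_Icc (a := (-1 : ℝ)) (b := 1)).exists_bound_of_continuousOn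
    (f := fun x => f x - f 0) (by fun_prop)
  have hB0 : 0 ≤ B := (norm_nonneg _).trans (hB 0 (by norm_num))
  have hkey : ∀ x : ℝ, |x| ≤ 1 → |f x - f 0| ≤ ε / 2 + B / δ ^ 2 * x ^ 2 := by
    intro x hx
    rcases lt_or_ge |x| δ with h | h
    · have h1 := hfδ (x := x) (by simpa [Real.dist_eq] using h)
      rw [Real.dist_eq] at h1
      have : 0 ≤ B / δ ^ 2 * x ^ 2 := by positivity
      linarith
    · have h1 : |f x - f 0| ≤ B := hB x (abs_le.1 hx)
      have h2 : 1 ≤ x ^ 2 / δ ^ 2 := by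
        rw [one_le_div (by positivity), ← sq_abs x]
        exact pow_le_pow_left₀ hδ.le h 2
      have h3 : B ≤ B / δ ^ 2 * x ^ 2 := by
        calc B ≤ B * (x ^ 2 / δ ^ 2) := le_mul_of_one_le_right hB0 h2
          _ = _ := by ring
      linarith
  have hsmall : ∀ᶠ n in l, ε / 2 + B / δ ^ 2 * q n < ε := by
    have : Tendsto (fun n => ε / 2 + B / δ ^ 2 * q n) l (𝓝 (ε / 2 + B / δ ^ 2 * 0)) :=
      tendsto_const_nhds.add (hq.const_mul _)
    exact this.eventually_lt_const (by linarith)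
  filter_upwards [hG, hsmall, hl (eventually_ge_atTop 1)] with n hGn hsn hn
  obtain ⟨e, he, he1, he2⟩ := exists_spec_eq (G n)
  have hn0 : (0 : ℝ) < n := by exact_mod_cast hn
  have hs : ((spec (walkMatrix (G n))).map f).sum = ∑ i, f (e i) := by
    rw [he, Multiset.map_map]
    rfl
  have h1 : 1 / (n : ℝ) * ∑ i, f (e i) - f 0 = (n : ℝ)⁻¹ * ∑ i, (f (e i) - f 0) := by
    rw [Finset.sum_sub_distrib, mul_sub]
    simp [hn0.ne']
  rw [hs, Real.dist_eq, h1, abs_mul, abs_of_pos (inv_pos.2 hn0)]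
  refine lt_of_le_of_lt ?_ hsn
  rw [inv_mul_le_iff₀ hn0]
  calc |∑ i, (f (e i) - f 0)| ≤ ∑ i, |f (e i) - f 0| := Finset.abs_sum_le_sum_abs _ _
    _ ≤ ∑ i, (ε / 2 + B / δ ^ 2 * e i ^ 2) := Finset.sum_le_sum fun i _ => hkey _ (he1 i)
    _ = n * (ε / 2) + B / δ ^ 2 * ∑ i, e i ^ 2 := by
        rw [Finset.sum_add_distrib, ← Finset.mul_sum]
        simp
    _ ≤ n * (ε / 2) + B / δ ^ 2 * (n * q n) := by
        have := he2.trans hGn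
        gcongr
    _ = n * (ε / 2 + B / δ ^ 2 * q n) := by ring

end Spectral

/-! ### Uniform points of the cube and the bottleneck distance -/

section Uniform

variable {d : ℕ}

lemma cube_eq_preimage (d : ℕ) :
    cube d = (MeasurableEquiv.toLp 2 (Fin d → ℝ)).symm ⁻¹' Set.Icc 0 1 := by
  ext x
  simp [cube, Pi.le_def, forall_and]

lemma measurableSet_cube (d : ℕ) : MeasurableSet (cube d) := by
  rw [cube_eq_preimage]
  exact (MeasurableEquiv.measurable _) measurableSet_Icc

lemma volume_cube (d : ℕ) : volume (cube d) = 1 := by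
  rw [cube_eq_preimage, (EuclideanSpace.volume_preserving_symm_measurableEquiv_toLp
    (Fin d)).measure_preimage measurableSet_Icc.nullMeasurableSet, Real.volume_Icc_pi]
  simp

lemma unitBallVolume_pos (d : ℕ) : 0 < unitBallVolume d :=
  ENNReal.toReal_pos (Metric.measure_ball_pos _ _ one_pos).ne' measure_ball_lt_top.ne

variable {Ω : Type*} [MeasurableSpace Ω] {P : Measure Ω} {X : Ω → E d}

lemma ae_mem_cube [IsProbabilityMeasure P] (hX : pdf.IsUniform X (cube d) P volume) :
    ∀ᵐ ω ∂P, X ω ∈ cube d := by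
  have h := hX.measure_preimage (by simp [volume_cube]) (by simp [volume_cube])
    (measurableSet_cube d)
  have hm : AEMeasurable X P := hX.aemeasurable (by simp [volume_cube]) (by simp [volume_cube])
  rw [Set.inter_self, volume_cube, div_one] at h
  exact (mem_ae_iff_prob_eq_one₀ (hm.nullMeasurable (measurableSet_cube d))).2 h

/-- The probability that a uniform point lies within `ρ` of one of `n` given points is at most the
total volume of the `n` balls of radius `ρ`. -/
lemma measureReal_near_le [IsProbabilityMeasure P] (hX : pdf.IsUniform X (cube d) P volume)
    {n : ℕ} (q : Fin n → E d) {ρ : ℝ} (hρ : 0 ≤ ρ) :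
    P.real {ω | ∃ i, ‖X ω - q i‖ ≤ ρ} ≤ n * (ρ ^ d * unitBallVolume d) := by
  have hset : {ω | ∃ i, ‖X ω - q i‖ ≤ ρ} = ⋃ i, X ⁻¹' Metric.closedBall (q i) ρ := by
    ext ω
    simp [dist_eq_norm]
  have hball : ∀ i, P.real (X ⁻¹' Metric.closedBall (q i) ρ) ≤ ρ ^ d * unitBallVolume d := by
    intro i
    have h := hX.measure_preimage (by simp [volume_cube]) (by simp [volume_cube])
      (Metric.isClosed_closedBall (x := q i) (ε := ρ)).measurableSet
    rw [measureReal_def, h, volume_cube, div_one]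
    have hb : volume.real (Metric.closedBall (q i) ρ) = ρ ^ d * unitBallVolume d := by
      rw [measureReal_def, Measure.addHaar_closedBall _ _ hρ, ENNReal.toReal_mul,
        finrank_euclideanSpace_fin, ENNReal.toReal_ofReal (by positivity)]
      rfl
    rw [← hb]
    exact measureReal_mono Set.inter_subset_right measure_closedBall_lt_top.ne
  rw [hset]
  calc P.real (⋃ i, X ⁻¹' Metric.closedBall (q i) ρ)
      ≤ ∑ i, P.real (X ⁻¹' Metric.closedBall (q i) ρ) := measureReal_iUnion_fintype_le _
    _ ≤ ∑ _i : Fin n, ρ ^ d * unitBallVolume d := Finset.sum_le_sum fun i _ => hball i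
    _ = n * (ρ ^ d * unitBallVolume d) := by simp

lemma exists_norm_sub_le_bottleneck {n : ℕ} (p q : Fin n → E d) (i : Fin n) :
    ∃ j, ‖p i - q j‖ ≤ bottleneck p q := by
  obtain ⟨σ, hσ⟩ := exists_eq_ciInf_of_finite
    (f := fun σ : Equiv.Perm (Fin n) => ⨆ i : Fin n, ‖p i - q (σ i)‖)
  refine ⟨σ i, ?_⟩
  rw [bottleneck, ← hσ]
  exact le_ciSup (f := fun i => ‖p i - q (σ i)‖) (Set.finite_range _).bddAbove i

lemma atTopIn_le_atTop (N : Set ℕ) : atTopIn N ≤ atTop := inf_le_left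

lemma eventually_mem_atTopIn (N : Set ℕ) : ∀ᶠ n in atTopIn N, n ∈ N :=
  mem_inf_of_right (mem_principal_self N)

/-- With probability at least `1/2` a single uniform point is at distance more than
`δ n^(-1/d)` from all `n` grid points, where `δ` depends only on `d`. Hence a matching distance
that is `o(r(n))` forces `r(n) n^(1/d) → ∞`. -/
lemma tendsto_radius_atTop [IsProbabilityMeasure P] (hd : 1 ≤ d) {N : Set ℕ}
    {X : (n : ℕ) → Fin n → Ω → E d}
    (hX : ∀ n ∈ N, ∀ i, pdf.IsUniform (X n i) (cube d) P volume) (D : (n : ℕ) → Fin n → E d)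
    {r : ℕ → ℝ}
    (hM : ∀ ε : ℝ, 0 < ε →
      Whp P N (fun n => {ω | bottleneck (fun i => X n i ω) (D n) ≤ ε * r n})) :
    Tendsto (fun n : ℕ => r n * (n : ℝ) ^ (1 / d : ℝ)) (atTopIn N) atTop := by
  have hπ := unitBallVolume_pos d
  have hd0 : (d : ℝ) ≠ 0 := by positivity
  set δ : ℝ := min 1 (1 / (2 * unitBallVolume d)) with hδ
  have hδ0 : 0 < δ := lt_min one_pos (by positivity)
  have hδπ : δ ^ d * unitBallVolume d ≤ 1 / 2 := by
    calc δ ^ d * unitBallVolume d ≤ δ * unitBallVolume d := by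
          have := pow_le_of_le_one hδ0.le (min_le_left _ _) (by omega : d ≠ 0)
          gcongr
      _ ≤ 1 / (2 * unitBallVolume d) * unitBallVolume d := by
          have := min_le_right 1 (1 / (2 * unitBallVolume d))
          gcongr
      _ = 1 / 2 := by field_simp
  rw [tendsto_atTop]
  intro K
  wlog hK : 0 < K generalizing K
  · exact (this 1 one_pos).mono fun n hn => (not_lt.1 hK).trans (zero_le_one.trans hn)
  obtain ⟨c, hc, hev⟩ := hM (δ / K) (by positivity)
  have hpow : Tendsto (fun n : ℕ => (n : ℝ) ^ (-c)) (atTopIn N) (𝓝 0) :=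
    ((tendsto_rpow_neg_atTop hc).comp tendsto_natCast_atTop_atTop).mono_left (atTopIn_le_atTop N)
  filter_upwards [hev, hpow.eventually_lt_const (by norm_num : (0 : ℝ) < 1 / 2),
    eventually_mem_atTopIn N, atTopIn_le_atTop N (eventually_ge_atTop 1)] with n hPn hcn hnN hn
  by_contra! hlt
  have hn0 : (0 : ℝ) < n := by exact_mod_cast hn
  set w : ℝ := (n : ℝ) ^ (1 / d : ℝ) with hw
  have hw0 : 0 < w := Real.rpow_pos_of_pos hn0 _
  have hwd : w ^ d = n := by
    rw [hw, ← Real.rpow_natCast, ← Real.rpow_mul hn0.le, one_div_mul_cancel hd0, Real.rpow_one]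
  have hρ : δ / K * r n ≤ δ / w := by
    rw [le_div_iff₀ hw0]
    calc δ / K * r n * w = δ / K * (r n * w) := by ring
      _ ≤ δ / K * K := by gcongr
      _ = δ := by field_simp
  have hsub : {ω | bottleneck (fun i => X n i ω) (D n) ≤ δ / K * r n} ⊆
      {ω | ∃ j, ‖X n ⟨0, hn⟩ ω - D n j‖ ≤ δ / w} := by
    intro ω hω
    obtain ⟨j, hj⟩ := exists_norm_sub_le_bottleneck (fun i => X n i ω) (D n) ⟨0, hn⟩
    exact ⟨j, hj.trans (le_trans hω hρ)⟩
  have h1 := (measureReal_mono hsub (measure_ne_top P _)).trans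
    (measureReal_near_le (hX n hnN ⟨0, hn⟩) (D n) (div_nonneg hδ0.le hw0.le))
  have h2 : n * ((δ / w) ^ d * unitBallVolume d) = δ ^ d * unitBallVolume d := by
    rw [div_pow, hwd]
    field_simp
  rw [h2] at h1
  linarith

end Uniform

/-! ### The two conclusions -/

section Conclusions

variable {d : ℕ}

/-- The bound on the mean inverse degree tends to `0` as soon as `r(n) n^(1/d) → ∞`. -/
lemma tendsto_clique_cover_div (hd : 1 ≤ d) {l : Filter ℕ} (hl : l ≤ atTop) {r : ℕ → ℝ}
    (hr : Tendsto (fun n : ℕ => r n * (n : ℝ) ^ (1 / d : ℝ)) l atTop) :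
    Tendsto (fun n : ℕ => 2 * (√d / r n + 1) ^ d / n) l (𝓝 0) := by
  have hd0 : (d : ℝ) ≠ 0 := by positivity
  have hw : Tendsto (fun n : ℕ => ((n : ℝ) ^ (1 / d : ℝ))⁻¹) l (𝓝 0) :=
    tendsto_inv_atTop_zero.comp
      (((tendsto_rpow_atTop (by positivity)).comp tendsto_natCast_atTop_atTop).mono_left hl)
  have h : Tendsto (fun n : ℕ => 2 * (√d * (r n * (n : ℝ) ^ (1 / d : ℝ))⁻¹ +
      ((n : ℝ) ^ (1 / d : ℝ))⁻¹) ^ d) l (𝓝 (2 * (√d * 0 + 0) ^ d)) :=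
    (((tendsto_inv_atTop_zero.comp hr).const_mul _).add hw).pow d |>.const_mul 2
  rw [mul_zero, add_zero, zero_pow (by omega), mul_zero] at h
  refine h.congr' ?_
  filter_upwards [hl (eventually_ge_atTop 1)] with n hn
  have hn0 : (0 : ℝ) < n := by exact_mod_cast hn
  have hwd : ((n : ℝ) ^ (1 / d : ℝ)) ^ d = n := by
    rw [← Real.rpow_natCast, ← Real.rpow_mul hn0.le, one_div_mul_cancel hd0, Real.rpow_one]
  have : √d * (r n * (n : ℝ) ^ (1 / d : ℝ))⁻¹ + ((n : ℝ) ^ (1 / d : ℝ))⁻¹ =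
      (√d / r n + 1) / (n : ℝ) ^ (1 / d : ℝ) := by
    rw [mul_inv, div_eq_mul_inv, div_eq_mul_inv]
    ring
  rw [this, div_pow, hwd]
  ring

/-- The constant `K_d` for which the mean inverse degree is at most `K_d / a` when `r ≤ √d`; it comes
from `√d / r + 1 ≤ 2 √d / r` in the count of cells. -/
noncomputable def inverseDegreeConst (d : ℕ) : ℝ := 2 * (2 * √d) ^ d * unitBallVolume d

lemma inverseDegreeConst_nonneg (d : ℕ) : 0 ≤ inverseDegreeConst d := by
  have := unitBallVolume_pos d
  unfold inverseDegreeConst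
  positivity

lemma wasserstein_geomGraph_le (hd : 1 ≤ d) {n : ℕ} (hn : 1 ≤ n) {p q : Fin n → E d}
    (hp : ∀ i, p i ∈ cube d) (hq : ∀ i, q i ∈ cube d) {r a : ℝ} (hr : 0 < r)
    (ha : a = n * unitBallVolume d * r ^ d) :
    wasserstein (spectralMeasure (walkMatrix (geomGraph p r)))
        (spectralMeasure (walkMatrix (geomGraph q r))) ≤
      ENNReal.ofReal (2 * √(min 1 (inverseDegreeConst d / a))) := by
  rcases le_total √d r with h | h
  · rw [geomGraph_eq_top hp h, geomGraph_eq_top hq h, wasserstein_self]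
    exact zero_le
  · have hn0 : (0 : ℝ) < n := by exact_mod_cast hn
    have hπ := unitBallVolume_pos d
    have key : ∀ p : Fin n → E d, (∀ i, p i ∈ cube d) →
        ∑ u, (deg (geomGraph p r) u)⁻¹ ≤ n * min 1 (inverseDegreeConst d / a) := by
      intro p hp
      rw [mul_min_of_nonneg _ _ hn0.le, mul_one]
      refine le_min sum_inv_deg_le_card ((sum_inv_deg_geomGraph_le hd hp hr).trans ?_)
      have h1 : n * (inverseDegreeConst d / a) = 2 * (2 * √d / r) ^ d := by
        rw [ha, inverseDegreeConst, div_pow]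
        field_simp
      have h2 : √d / r + 1 ≤ 2 * √d / r := by
        rw [mul_div_assoc, two_mul]
        linarith [(one_le_div hr).2 h]
      rw [h1]
      gcongr
    exact wasserstein_walkMatrix_le hn _ _ (key p hp) (key q hq)

/-- If the deterministic bound does not already exclude `t / a^(1/4)`, then `t⁸ a` is bounded in
terms of `d`. With `s = a^(1/4)`, the two parts of the minimum give `t < 2 s` and `t s < 2 √K`,
of which the first is used for `s ≤ 1` and the second for `s ≥ 1`. -/
lemma pow_eight_mul_le {K a t : ℝ} (hK : 0 ≤ K) (ha : 0 < a) (ht : 0 < t)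
    (h : t / a ^ (1 / 4 : ℝ) < 2 * √(min 1 (K / a))) :
    t < 2 * a ^ (1 / 4 : ℝ) ∧ t ^ 8 * a ≤ 256 * (1 + K ^ 4) := by
  set s : ℝ := a ^ (1 / 4 : ℝ) with hs
  have hs0 : 0 < s := Real.rpow_pos_of_pos ha _
  have hs4 : s ^ 4 = a := by
    rw [hs, ← Real.rpow_natCast, ← Real.rpow_mul ha.le]
    norm_num
  have h1 : t < 2 * s := by
    have : √(min 1 (K / a)) ≤ 1 := Real.sqrt_le_one.2 (min_le_left _ _)
    rw [div_lt_iff₀ hs0] at h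
    nlinarith
  have h2 : t * s ≤ 2 * √K := by
    have h3 : √(min 1 (K / a)) ≤ √K / s ^ 2 := by
      calc √(min 1 (K / a)) ≤ √(K / a) := Real.sqrt_le_sqrt (min_le_right _ _)
        _ = √K / s ^ 2 := by
          rw [Real.sqrt_div hK, ← hs4, show s ^ 4 = (s ^ 2) ^ 2 by ring,
            Real.sqrt_sq (sq_nonneg s)]
    have h4 : t / s ≤ 2 * (√K / s ^ 2) := by linarith
    calc t * s = t / s * s ^ 2 := by field_simp
      _ ≤ 2 * (√K / s ^ 2) * s ^ 2 := by gcongr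
      _ = 2 * √K := by field_simp
  refine ⟨h1, ?_⟩
  have hK4 : 0 ≤ K ^ 4 := by positivity
  rw [← hs4]
  rcases le_total s 1 with hs1 | hs1
  · calc t ^ 8 * s ^ 4 ≤ (2 * s) ^ 8 * s ^ 4 := by gcongr
      _ = 256 * s ^ 12 := by ring
      _ ≤ 256 * 1 := by gcongr; exact pow_le_one₀ hs0.le hs1
      _ ≤ 256 * (1 + K ^ 4) := by linarith
  · calc t ^ 8 * s ^ 4 ≤ t ^ 8 * s ^ 8 := by
          gcongr
          norm_num
      _ = (t * s) ^ 8 := by ring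
      _ ≤ (2 * √K) ^ 8 := by gcongr
      _ = 256 * ((√K) ^ 2) ^ 4 := by ring
      _ = 256 * K ^ 4 := by rw [Real.sq_sqrt hK]
      _ ≤ 256 * (1 + K ^ 4) := by linarith

lemma one_le_concentration_bound {K a t : ℝ} (hK : 0 ≤ K) (ha : 0 < a) (ht : 0 < t) {n : ℕ}
    (hn : 1 ≤ n) (h : t / a ^ (1 / 4 : ℝ) < 2 * √(min 1 (K / a))) :
    1 ≤ 16 * n * a ^ (1 / 4 : ℝ) / t *
      (2 * Real.exp (-(1 / 2) * (t ^ 4 / (8 * t ^ 4 + 4096)) ^ 2 * a) +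
        Real.exp (-(2 / (1 + K ^ 4)) * (t ^ 8 / 512) * a)) := by
  obtain ⟨h1, h2⟩ := pow_eight_mul_le hK ha ht h
  have hn1 : (1 : ℝ) ≤ n := by exact_mod_cast hn
  have hs0 : 0 < a ^ (1 / 4 : ℝ) := Real.rpow_pos_of_pos ha _
  have hfac : 8 ≤ 16 * n * a ^ (1 / 4 : ℝ) / t := by
    rw [le_div_iff₀ ht]
    nlinarith
  have hexp : Real.exp (-1) ≤ Real.exp (-(2 / (1 + K ^ 4)) * (t ^ 8 / 512) * a) := by
    rw [Real.exp_le_exp]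
    have hK4 : 0 < 1 + K ^ 4 := by positivity
    have : 2 / (1 + K ^ 4) * (t ^ 8 / 512) * a = t ^ 8 * a / (256 * (1 + K ^ 4)) := by
      field_simp
      norm_num
    have h3 : t ^ 8 * a / (256 * (1 + K ^ 4)) ≤ 1 := (div_le_one (by positivity)).2 h2
    linarith
  have he : 1 / 8 ≤ Real.exp (-1) := by
    rw [Real.exp_neg, one_div]
    exact inv_anti₀ (Real.exp_pos 1) (by linarith [Real.exp_one_lt_d9])
  have hpos := Real.exp_pos (-(1 / 2) * (t ^ 4 / (8 * t ^ 4 + 4096)) ^ 2 * a)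
  nlinarith

variable {Ω : Type*} [MeasurableSpace Ω] {P : Measure Ω} [IsProbabilityMeasure P] {N : Set ℕ}
  {X : (n : ℕ) → Fin n → Ω → E d} {D : (n : ℕ) → Fin n → E d} {r : ℕ → ℝ}

lemma asympEquidistributedWhp_geomGraph (hd : 1 ≤ d)
    (hXm : ∀ n ∈ N, ∀ i, Measurable (X n i))
    (hXu : ∀ n ∈ N, ∀ i, pdf.IsUniform (X n i) (cube d) P volume)
    (hD : ∀ n ∈ N, ∀ i, D n i ∈ cube d) (hr : ∀ n ∈ N, 0 < r n)
    (hM : ∀ ε : ℝ, 0 < ε →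
      Whp P N (fun n => {ω | bottleneck (fun i => X n i ω) (D n) ≤ ε * r n})) :
    AsympEquidistributedWhp P N
      (fun n ω => spec (walkMatrix (geomGraph (fun i => X n i ω) (r n))))
      (fun n _ => spec (walkMatrix (geomGraph (D n) (r n)))) := by
  have hq := tendsto_clique_cover_div hd (atTopIn_le_atTop N) (tendsto_radius_atTop hd hXu D hM)
  have hdeg : ∀ {n : ℕ} {p : Fin n → E d}, 1 ≤ n → n ∈ N → (∀ i, p i ∈ cube d) →
      ∑ u, (deg (geomGraph p (r n)) u)⁻¹ ≤ n * (2 * (√d / r n + 1) ^ d / n) := by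
    intro n p hn hnN hp
    have hn0 : (n : ℝ) ≠ 0 := by positivity
    rw [mul_div_cancel₀ _ hn0]
    exact sum_inv_deg_geomGraph_le hd hp (hr n hnN)
  refine ⟨fun n => {ω | n ∈ N → ∀ i, X n i ω ∈ cube d}, fun n => ?_, ⟨1, one_pos, ?_⟩, ?_⟩
  · by_cases hn : n ∈ N
    · simp only [hn, true_imp_iff, Set.ofPred_forall]
      exact MeasurableSet.iInter fun i => hXm n hn i (measurableSet_cube d)
    · simp [hn]
  · filter_upwards [eventually_mem_atTopIn N, atTopIn_le_atTop N (eventually_ge_atTop 1)]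
      with n hnN hn
    have h1 : ∀ᵐ ω ∂P, n ∈ N → ∀ i, X n i ω ∈ cube d := by
      filter_upwards [ae_all_iff.2 fun i => ae_mem_cube (hXu n hnN i)] with ω hω _ using hω
    have h2 : P.real {ω | n ∈ N → ∀ i, X n i ω ∈ cube d} = 1 := by
      rw [measureReal_congr (eventuallyEq_univ.2 h1), probReal_univ]
    have : (0 : ℝ) < (n : ℝ) ^ (-1 : ℝ) := Real.rpow_pos_of_pos (by exact_mod_cast hn) _
    rw [h2]
    linarith
  · intro ω hω f hf
    have hX := tendsto_mean_spec (atTopIn_le_atTop N)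
      (fun n => geomGraph (fun i => X n i (ω n)) (r n)) hq
      (by
        filter_upwards [hω, eventually_mem_atTopIn N,
          atTopIn_le_atTop N (eventually_ge_atTop 1)] with n h hnN hn
        exact hdeg hn hnN (h hnN)) hf
    have hD' := tendsto_mean_spec (atTopIn_le_atTop N) (fun n => geomGraph (D n) (r n)) hq
      (by
        filter_upwards [eventually_mem_atTopIn N,
          atTopIn_le_atTop N (eventually_ge_atTop 1)] with n hnN hn
        exact hdeg hn hnN (hD n hnN)) hf
    simpa using (hX.sub hD').abs

lemma measureReal_wasserstein_geomGraph_le (hd : 1 ≤ d) {n : ℕ} (hn : 1 ≤ n)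
    {X : Fin n → Ω → E d} {q : Fin n → E d}
    (hX : ∀ i, pdf.IsUniform (X i) (cube d) P volume) (hq : ∀ i, q i ∈ cube d)
    {r a t : ℝ} (hr : 0 < r) (ht : 0 < t) (ha : a = n * unitBallVolume d * r ^ d) :
    P.real {ω | ENNReal.ofReal (t / a ^ (1 / 4 : ℝ)) <
        wasserstein (spectralMeasure (walkMatrix (geomGraph (fun i => X i ω) r)))
          (spectralMeasure (walkMatrix (geomGraph q r)))} ≤
      16 * n * a ^ (1 / 4 : ℝ) / t *
        (2 * Real.exp (-(1 / 2) * (t ^ 4 / (8 * t ^ 4 + 4096)) ^ 2 * a) +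
          Real.exp (-(2 / (1 + inverseDegreeConst d ^ 4)) * (t ^ 8 / 512) * a)) := by
  have hπ := unitBallVolume_pos d
  have hn0 : (0 : ℝ) < n := by exact_mod_cast hn
  have ha0 : 0 < a := by rw [ha]; positivity
  rcases lt_or_ge (t / a ^ (1 / 4 : ℝ)) (2 * √(min 1 (inverseDegreeConst d / a))) with h | h
  · exact measureReal_le_one.trans
      (one_le_concentration_bound (inverseDegreeConst_nonneg d) ha0 ht hn h)
  · have hnull : ∀ᵐ ω ∂P, ¬ ENNReal.ofReal (t / a ^ (1 / 4 : ℝ)) <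
        wasserstein (spectralMeasure (walkMatrix (geomGraph (fun i => X i ω) r)))
          (spectralMeasure (walkMatrix (geomGraph q r))) := by
      filter_upwards [ae_all_iff.2 fun i => ae_mem_cube (hX i)] with ω hω
      rw [not_lt]
      exact (wasserstein_geomGraph_le hd hn hω hq hr ha).trans (ENNReal.ofReal_le_ofReal h)
    have h0 : P {ω | ENNReal.ofReal (t / a ^ (1 / 4 : ℝ)) <
        wasserstein (spectralMeasure (walkMatrix (geomGraph (fun i => X i ω) r)))
          (spectralMeasure (walkMatrix (geomGraph q r)))} = 0 := by
      simpa [ae_iff] using hnull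
    rw [measureReal_def, h0, ENNReal.toReal_zero]
    positivity

end Conclusions

end RGG

theorem theorem1 (d : ℕ) (hd : 1 ≤ d) :
    ∃ c : ℝ, 0 < c ∧
      ∀ (Ω : Type*) [MeasurableSpace Ω] (P : Measure Ω) [IsProbabilityMeasure P]
        (N : Set ℕ) (_ : N.Infinite)
        -- for each size `n`, independent uniform points of the cube
        (X : (n : ℕ) → Fin n → Ω → RGG.E d)
        (_ : ∀ n ∈ N, ∀ i, Measurable (X n i))
        (_ : ∀ n ∈ N, iIndepFun (X n) P)
        (_ : ∀ n ∈ N, ∀ i, pdf.IsUniform (X n i) (RGG.cube d) P volume)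
        -- the grids
        (D : (n : ℕ) → Fin n → RGG.E d)
        (_ : ∀ n ∈ N, RGG.IsGrid (D n))
        -- the radii, and `M_n = o(r(n))` with high probability
        (r : ℕ → ℝ)
        (_ : ∀ n ∈ N, 0 < r n)
        (_ : ∀ ε : ℝ, 0 < ε →
          RGG.Whp P N (fun n => {ω | RGG.bottleneck (fun i => X n i ω) (D n) ≤ ε * r n})),
        RGG.AsympEquidistributedWhp P N
            (fun n ω => RGG.spec (RGG.walkMatrix (RGG.geomGraph (fun i => X n i ω) (r n))))
            (fun n _ => RGG.spec (RGG.walkMatrix (RGG.geomGraph (D n) (r n)))) ∧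
          ∀ n ∈ N, 1 ≤ n → ∀ t : ℝ, 0 < t → ∀ a : ℝ, a = n * RGG.unitBallVolume d * r n ^ d →
            P.real {ω | ENNReal.ofReal (t / a ^ (1 / 4 : ℝ)) <
                RGG.wasserstein
                  (RGG.spectralMeasure
                    (RGG.walkMatrix (RGG.geomGraph (fun i => X n i ω) (r n))))
                  (RGG.spectralMeasure (RGG.walkMatrix (RGG.geomGraph (D n) (r n))))} ≤
              16 * n * a ^ (1 / 4 : ℝ) / t *
                (2 * Real.exp (-(1 / 2) * (t ^ 4 / (8 * t ^ 4 + 4096)) ^ 2 * a) +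
                  Real.exp (-c * (t ^ 8 / 512) * a)) := by
  have hK := RGG.inverseDegreeConst_nonneg d
  refine ⟨2 / (1 + RGG.inverseDegreeConst d ^ 4), by positivity, ?_⟩
  intro Ω _ P _ N _ X hXm _ hXu D hD r hr hM
  refine ⟨RGG.asympEquidistributedWhp_geomGraph hd hXm hXu (fun n hn => (hD n hn).mem_cube) hr hM,
    fun n hnN hn t ht a ha => ?_⟩
  exact RGG.measureReal_wasserstein_geomGraph_le hd hn (hXu n hnN) (hD n hnN).mem_cube
    (hr n hnN) ht ha
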